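/- Let $K$ be a field of characteristic different from $2$, let $\Gamma=(\Gamma_0,\Gamma_1)$ be a finite quiver without oriented cycles and with $|\Gamma_0|\ge 2$, and let $\rho$ be a set of relations on $\Gamma$, i.e. of $K$-linear combinations $\sum_i k_ip_i$ of paths $p_i$ of length at least $2$, all having the same starting vertex and the same end vertex. Let $\Gamma^*$ be the quiver with vertex set $\Gamma_0$ and with one arrow $\alpha^*\colon i\to j$ for each arrow $\alpha\colon j\to i$ of $\Gamma$; for a path $p=\alpha_n\cdots\alpha_1$ of $\Gamma$ (first $\alpha_1$, then $\alpha_2$, and so on) write $p^*=\alpha_1^*\cdots\alpha_n^*$, and let $\rho^*$ be the set of the elements $\sum_i k_ip_i^*$ with $\sum_i k_ip_i\in\rho$. For $\Lambda=K(\Gamma,\rho)=K\Gamma/\langle\rho\rangle$, the generalized one-point extension $E(\Lambda)$ is the quotient of the path algebra over $K$ of the quiver $(\Gamma_0,\Gamma_1\sqcup\Gamma_1^*)$ by the two-sided ideal generated by $$\rho\ \cup\ \rho^*\ \cup\ \{\alpha\beta^*\mid \alpha,\beta\in\Gamma_1\}\ \cup\ \{\alpha^*\beta\mid\alpha,\beta\in\Gamma_1\}.$$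 Write $[a,b]=ab-ba$. Let $\Theta\colon E(\Lambda)\to E(\Lambda)$ be a Lie derivation, i.e. a $K$-linear map with $\Theta([a,b])=[\Theta(a),b]+[a,\Theta(b)]$ for all $a,b\in E(\Lambda)$. Then $\Theta$ is standard, and its standard decomposition is unique: there is exactly one pair $(D,\Delta)$ of $K$-linear maps $E(\Lambda)\to E(\Lambda)$ such that $\Theta=D+\Delta$, $D(ab)=D(a)b+aD(b)$ for all $a,b\in E(\Lambda)$, and $\Delta$ takes values in the center of $E(\Lambda)$ and satisfies $\Delta([a,b])=0$ for all $a,b\in E(\Lambda)$. -/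

import Mathlib

universe u v w

/-- A path of the quiver `V`, trivial or not, together with its starting vertex `src` and its end
vertex `tgt`. -/
structure QPath (V : Type u) [Quiver.{v} V] where
  src : V
  tgt : V
  path : Quiver.Path src tgt

/-- An oriented cycle is a path of positive length that ends where it starts. -/
def HasNoOrientedCycles (V : Type u) [Quiver.{v} V] : Prop :=
  ∀ (a : V) (p : Quiver.Path a a), p.length = 0

/-- The underlying vector space of the path algebra `KV`: the paths form a basis. -/
def PathAlgebra (K : Type w) [Field K] (V : Type u) [Quiver.{v} V] : Type (max u v w) :=
  QPath V →₀ K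

namespace PathAlgebra

variable {K : Type w} [Field K] {V : Type u} [Quiver.{v} V]

noncomputable instance instAddCommGroup : AddCommGroup (PathAlgebra K V) :=
  inferInstanceAs (AddCommGroup (QPath V →₀ K))

noncomputable instance instModule : Module K (PathAlgebra K V) :=
  inferInstanceAs (Module K (QPath V →₀ K))

/-- The basis element given by a path. -/
noncomputable def of (K : Type w) [Field K] {V : Type u} [Quiver.{v} V] (p : QPath V) :
    PathAlgebra K V :=
  (Finsupp.single p 1 : QPath V →₀ K)

/-- The linear extension of a map defined on paths. -/
noncomputable def extend {M : Type*} [AddCommGroup M] [Module K M] (f : QPath V → M) :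
    PathAlgebra K V →ₗ[K] M :=
  Finsupp.linearCombination K f

@[simp] theorem extend_of {M : Type*} [AddCommGroup M] [Module K M] (f : QPath V → M)
    (p : QPath V) : extend (K := K) f (of K p) = f p :=
  (Finsupp.linearCombination_single K 1 p).trans (one_smul K (f p))

theorem hom_ext {M : Type*} [AddCommGroup M] [Module K M] {f g : PathAlgebra K V →ₗ[K] M}
    (h : ∀ p, f (of K p) = g (of K p)) : f = g :=
  Finsupp.lhom_ext' fun p => LinearMap.ext_ring (h p)

open Classical in
/-- The product `x y` of two paths is the path "first `y`, then `x`" when the end of `y` is the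
start of `x`, and `0` otherwise. -/
noncomputable def mulPath (K : Type w) [Field K] {V : Type u} [Quiver.{v} V] (x y : QPath V) :
    PathAlgebra K V :=
  if h : y.tgt = x.src then of K ⟨y.src, x.tgt, y.path.comp (x.path.cast h.symm rfl)⟩ else 0

/-- The bilinear extension of the product of paths. -/
noncomputable def mulBilin (K : Type w) [Field K] (V : Type u) [Quiver.{v} V] :
    PathAlgebra K V →ₗ[K] PathAlgebra K V →ₗ[K] PathAlgebra K V :=
  extend fun x => extend fun y => mulPath K x y

theorem mulBilin_of (x y : QPath V) : mulBilin K V (of K x) (of K y) = mulPath K x y := by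
  simp [mulBilin]

theorem mulPath_assoc (x y z : QPath V) :
    mulBilin K V (mulPath K x y) (of K z) = mulBilin K V (of K x) (mulPath K y z) := by
  obtain ⟨a, b, p⟩ := x
  obtain ⟨c, d, q⟩ := y
  obtain ⟨e, f, r⟩ := z
  by_cases h₁ : d = a
  · subst h₁
    by_cases h₂ : f = c
    · subst h₂
      simp [mulPath, mulBilin_of]
    · simp [mulPath, mulBilin_of, h₂]
  · by_cases h₂ : f = c
    · subst h₂
      simp [mulPath, mulBilin_of, h₁]
    · simp [mulPath, h₁, h₂]

theorem mulBilin_assoc (x y z : PathAlgebra K V) :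
    mulBilin K V (mulBilin K V x y) z = mulBilin K V x (mulBilin K V y z) := by
  have h : (LinearMap.llcomp K (PathAlgebra K V) (PathAlgebra K V)
        (PathAlgebra K V →ₗ[K] PathAlgebra K V) (mulBilin K V)).comp (mulBilin K V) =
      ((LinearMap.llcomp K (PathAlgebra K V) (PathAlgebra K V) (PathAlgebra K V)).comp
        (mulBilin K V)).compl₂ (mulBilin K V) := by
    refine hom_ext fun x => hom_ext fun y => hom_ext fun z => ?_
    simpa [mulBilin_of] using mulPath_assoc x y z
  simpa using LinearMap.congr_fun (LinearMap.congr_fun (LinearMap.congr_fun h x) y) z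

/-- The trivial path at a vertex, as an element of the path algebra. -/
noncomputable def idem (K : Type w) [Field K] {V : Type u} [Quiver.{v} V] (i : V) :
    PathAlgebra K V :=
  of K ⟨i, i, Quiver.Path.nil⟩

/-- An arrow, as an element of the path algebra. -/
noncomputable def arrow (K : Type w) [Field K] {V : Type u} [Quiver.{v} V] {i j : V}
    (α : i ⟶ j) : PathAlgebra K V :=
  of K ⟨i, j, α.toPath⟩

variable [Fintype V]

theorem one_mulBilin (x : PathAlgebra K V) : mulBilin K V (∑ i : V, idem K i) x = x := by
  have h : mulBilin K V (∑ i : V, idem K i) = LinearMap.id := by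
    refine hom_ext fun p => ?_
    rw [map_sum, LinearMap.sum_apply, Finset.sum_eq_single p.tgt]
    · simp [idem, mulBilin_of, mulPath]
    · intro b _ hb
      simp [idem, mulBilin_of, mulPath, hb.symm]
    · simp
  simp [h]

theorem mulBilin_one (x : PathAlgebra K V) : mulBilin K V x (∑ i : V, idem K i) = x := by
  have h : (mulBilin K V).flip (∑ i : V, idem K i) = LinearMap.id := by
    refine hom_ext fun p => ?_
    rw [map_sum, LinearMap.sum_apply, Finset.sum_eq_single p.src]
    · simp [idem, mulBilin_of, mulPath]
    · intro b _ hb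
      simp [idem, mulBilin_of, mulPath, hb]
    · simp
  simpa using LinearMap.congr_fun h x

/-- The path algebra of a quiver with finitely many vertices is a unital ring, with identity the
sum of the trivial paths. -/
noncomputable instance instRing : Ring (PathAlgebra K V) :=
  { (inferInstance : AddCommGroup (PathAlgebra K V)) with
    mul := fun x y => mulBilin K V x y
    one := ∑ i : V, idem K i
    mul_assoc := mulBilin_assoc
    one_mul := one_mulBilin
    mul_one := mulBilin_one
    left_distrib := fun x y z => map_add (mulBilin K V x) y z
    right_distrib := fun x y z => LinearMap.map_add₂ (mulBilin K V) x y z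
    zero_mul := fun x => LinearMap.map_zero₂ (mulBilin K V) x
    mul_zero := fun x => map_zero (mulBilin K V x) }

noncomputable instance instAlgebra : Algebra K (PathAlgebra K V) :=
  Algebra.ofModule (fun r x y => LinearMap.map_smul₂ (mulBilin K V) r x y)
    (fun r x y => map_smul (mulBilin K V x) r y)

theorem of_mul_of (x y : QPath V) : of K x * of K y = mulPath K x y := mulBilin_of x y

theorem one_def : (1 : PathAlgebra K V) = ∑ i : V, idem K i := rfl

end PathAlgebra

/-- A relation: a linear combination of paths with a common start and a common end, all of length
at least `2`. -/
def IsQuiverRelation {K : Type w} [Field K] {V : Type u} [Quiver.{v} V]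
    (σ : PathAlgebra K V) : Prop :=
  ∃ a b : V, ∀ p ∈ Finsupp.support (α := QPath V) (M := K) σ, p.src = a ∧ p.tgt = b ∧ 2 ≤ p.path.length

/-- The algebra `K(V, ρ)` of a quiver with relations: the path algebra modulo the two-sided ideal
generated by `ρ`. -/
abbrev BoundQuiverAlgebra (K : Type w) [Field K] (V : Type u) [Quiver.{v} V] [Fintype V]
    (ρ : Set (PathAlgebra K V)) : Type (max u v w) :=
  (TwoSidedIdeal.span ρ).ringCon.Quotient

section Extension

open Quiver

instance symmetrifyFintype {V : Type u} [Fintype V] : Fintype (Symmetrify V) := inferInstanceAs (Fintype V)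

/-- The path `p`, regarded in the quiver `Symmetrify V` with arrows `α : i ⟶ j` (`α.toPos`) and
`α* : j ⟶ i` (`α.toNeg`) for each arrow `α : i ⟶ j` of `V`. -/
def QPath.pos {V : Type u} [Quiver.{v} V] (p : QPath V) : QPath (Symmetrify V) :=
  ⟨p.src, p.tgt, Symmetrify.of.mapPath p.path⟩

/-- The path `p* = α₁* ⋯ αₙ*` for `p = αₙ ⋯ α₁`. -/
def QPath.star {V : Type u} [Quiver.{v} V] (p : QPath V) : QPath (Symmetrify V) :=
  ⟨p.tgt, p.src, (Symmetrify.of.mapPath p.path).reverse⟩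

namespace PathAlgebra

variable {K : Type w} [Field K] {V : Type u} [Quiver.{v} V]

/-- The linear extension of `p ↦ p` to the path algebra of the doubled quiver. -/
noncomputable def pos : PathAlgebra K V →ₗ[K] PathAlgebra K (Symmetrify V) :=
  extend fun p => of K p.pos

/-- The linear extension of `p ↦ p*` to the path algebra of the doubled quiver. -/
noncomputable def star : PathAlgebra K V →ₗ[K] PathAlgebra K (Symmetrify V) :=
  extend fun p => of K p.star

end PathAlgebra

/-- The relations `ρ ∪ ρ* ∪ {α β*} ∪ {α* β}` on the doubled quiver, where `α` and `β` range over all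
arrows of `V`. -/
def extensionRelations {K : Type w} [Field K] {V : Type u} [Quiver.{v} V] [Fintype V]
    (ρ : Set (PathAlgebra K V)) : Set (PathAlgebra K (Symmetrify V)) :=
  PathAlgebra.pos '' ρ ∪ PathAlgebra.star '' ρ ∪
    {x | ∃ (i j k l : V) (α : i ⟶ j) (β : k ⟶ l),
      x = PathAlgebra.arrow K α.toPos * PathAlgebra.arrow K β.toNeg} ∪
    {x | ∃ (i j k l : V) (α : i ⟶ j) (β : k ⟶ l),
      x = PathAlgebra.arrow K α.toNeg * PathAlgebra.arrow K β.toPos}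

/-- The generalized one-point extension `E(Λ)` of `Λ = K(V, ρ)`. -/
abbrev GenOnePointExtension (K : Type w) [Field K] (V : Type u) [Quiver.{v} V] [Fintype V]
    (ρ : Set (PathAlgebra K V)) : Type (max u v w) :=
  BoundQuiverAlgebra K (Symmetrify V) (extensionRelations ρ)

end Extension

/-- An (associative) derivation of a possibly noncommutative algebra. -/
def IsAssocDerivation {K : Type*} {A : Type*} [CommRing K] [Ring A] [Algebra K A]
    (D : A →ₗ[K] A) : Prop :=
  ∀ a b : A, D (a * b) = D a * b + a * D b

/-- A Lie derivation of an associative algebra, with respect to the commutator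
`[a, b] = a b - b a`. -/
def IsLieDerivation {K : Type*} {A : Type*} [CommRing K] [Ring A] [Algebra K A]
    (Θ : A →ₗ[K] A) : Prop :=
  ∀ a b : A, Θ (a * b - b * a) = (Θ a * b - b * Θ a) + (a * Θ b - Θ b * a)

/-- `(D, Δ)` is a standard decomposition of `Θ`: `Θ = D + Δ` with `D` a derivation and `Δ` a linear
map into the center that vanishes on all commutators. -/
def IsStandardDecomposition {K : Type*} {A : Type*} [CommRing K] [Ring A] [Algebra K A]
    (Θ D Δ : A →ₗ[K] A) : Prop :=
  IsAssocDerivation D ∧ (∀ a : A, Δ a ∈ Subalgebra.center K A) ∧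
    (∀ a b : A, Δ (a * b - b * a) = 0) ∧ Θ = D + Δ

/-! The vertices give complete orthogonal idempotents `e i` of E(Λ). A path mixing arrows and
starred arrows is zero there, so, without oriented cycles in `V`, every cycle of positive length is
zero (`toExtension_cycle`). Hence the diagonal Peirce components are spanned by the `e i`, and
products of opposite off-diagonal components vanish. The rest of the argument needs only these two
facts and 2 ≠ 0.

Subtracting an inner derivation makes every `T (e i)` diagonal (`exists_diagonalizing`). Then `T`
preserves each off-diagonal component and every `T (e i)` is central. Take Δ equal to `T` on the
diagonal and zero off it: its values are central, and `T - Δ` is a derivation, as is checked on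
Peirce components (`standard_of_diagonal`). Uniqueness holds because a derivation that is
central-valued and kills commutators is zero (`derivation_eq_zero`). -/

/-- Complete orthogonal idempotents whose diagonal Peirce components are spanned by the idempotents
and such that products of opposite off-diagonal Peirce components vanish. -/
structure HasThinPeirce (K : Type*) {A ι : Type*} [Field K] [Ring A] [Algebra K A] [Fintype ι]
    (e : ι → A) : Prop where
  complete : CompleteOrthogonalIdempotents e
  diag : ∀ i x, ∃ c : K, e i * x * e i = c • e i
  offDiag : ∀ i j, i ≠ j → ∀ x y, (e i * x * e j) * (e j * y * e i) = 0

/-! ### Lie derivations of algebras with thin Peirce decomposition -/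

section Peirce

variable {K A ι : Type*} [Field K] [Ring A] [Algebra K A] {e : ι → A}

theorem commute_homogeneous_sub {t : A}
    (ht : ∀ k, e k * t = t * e k) {i j : ι} {x : A} (hl : e i * x = x) (hr : x * e j = x) :
    e i * (t * x - x * t) = t * x - x * t ∧ (t * x - x * t) * e j = t * x - x * t := by
  constructor
  · rw [mul_sub, ← mul_assoc, ht, mul_assoc, hl, ← mul_assoc, hl]
  · rw [sub_mul, mul_assoc, hr, mul_assoc x, ← ht, ← mul_assoc x, hr]

theorem two_cancel (h2 : (2 : K) ≠ 0) {x : A} (h : x = -x) : x = 0 := by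
  have h' : (2 : K) • x = 0 := by
    rw [two_smul]; nth_rewrite 1 [h]; simp
  exact (smul_eq_zero_iff_right h2).1 h'

/-- A Lie derivation mapping the idempotents to the diagonal preserves off-diagonal Peirce
components, and maps the idempotents to elements commuting with these. -/
theorem IsLieDerivation.homogeneous (h2 : (2 : K) ≠ 0) (he : OrthogonalIdempotents e)
    {T : A →ₗ[K] A} (hT : IsLieDerivation T) (hd : ∀ i k, e k * T (e i) = T (e i) * e k)
    {i j : ι} (hij : i ≠ j) {x : A} (hl : e i * x = x) (hr : x * e j = x) :
    (e i * T x = T x ∧ T x * e j = T x) ∧ ∀ k, T (e k) * x = x * T (e k) := by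
  have hxi : x * e i = 0 := by rw [← hr, mul_assoc, he.ortho hij.symm, mul_zero]
  have hjx : e j * x = 0 := by rw [← hl, ← mul_assoc, he.ortho hij.symm, zero_mul]
  -- Since x = [e i, x] = [x, e j], the Lie identity expresses `T x` in two ways. Multiplying these
  -- by `e i` and by `e j` isolates the unwanted components of `T x`.
  have h₁ := hT (e i) x
  have h₃ := hT x (e j)
  rw [hl, hxi, sub_zero] at h₁
  rw [hr, hjx, sub_zero] at h₃
  obtain ⟨zl, zr⟩ := commute_homogeneous_sub (hd i) hl hr
  obtain ⟨wl, wr⟩ := commute_homogeneous_sub (hd j) hl hr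
  set z := T (e i) * x - x * T (e i)
  have hw : x * T (e j) - T (e j) * x = -(T (e j) * x - x * T (e j)) := by abel
  rw [hw] at h₃
  set w := T (e j) * x - x * T (e j)
  set y := T x with hy
  have hi := (he.idem i).eq
  have hj := (he.idem j).eq
  have z1 : z = e i * y * e i := by
    have h := congrArg (e i * ·) h₁
    simp only [mul_add, mul_sub, zl, ← mul_assoc, hi] at h
    have h' : z - e i * y * e i = 0 := by
      rw [← sub_eq_zero] at h; rw [← neg_eq_zero]; rw [← h]; abel
    exact sub_eq_zero.1 h'
  have z0 : z = 0 := by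
    rw [← zr, z1, mul_assoc, he.ortho hij, mul_zero]
  -- With z = 0 the identity reads y = [e i, y]; right multiplication by `e i` gives y e i = -(y e
  -- i), hence the need for 2 ≠ 0.
  have yi : y * e i = 0 := by
    apply two_cancel h2
    have h := congrArg (· * e i) h₁
    simp only [sub_mul, z0, mul_assoc, hi, zero_add] at h
    rw [z0, mul_assoc] at z1
    rwa [← z1, zero_sub] at h
  have w1 : w = e j * y * e j * (-1) := by
    have h := congrArg (· * e j) h₃
    simp only [add_mul, sub_mul, neg_mul, wr, mul_assoc, hj] at h
    have h' : w + e j * (y * e j) = 0 := by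
      rw [← sub_eq_zero] at h; rw [← h]; abel
    rw [mul_neg_one, mul_assoc]
    exact eq_neg_of_add_eq_zero_left h'
  have w0 : w = 0 := by
    rw [← wl, w1]; simp only [← mul_assoc, he.ortho hij, zero_mul]
  have yj : e j * y = 0 := by
    apply two_cancel h2
    have h := congrArg (e j * ·) h₃
    simp only [mul_sub, w0, ← mul_assoc, hj, neg_zero, add_zero] at h
    rw [w0, mul_neg_one, eq_comm, neg_eq_zero] at w1
    rwa [w1, zero_sub] at h
  have hiy : e i * y = y := by
    rw [z0, yi] at h₁; simpa using h₁.symm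
  have hyj : y * e j = y := by
    rw [w0, yj] at h₃; simpa using h₃.symm
  refine ⟨⟨hiy, hyj⟩, fun k => ?_⟩
  by_cases hki : k = i
  · subst hki; exact sub_eq_zero.1 z0
  by_cases hkj : k = j
  · subst hkj; exact sub_eq_zero.1 w0
  have a1 : e k * x = 0 := by rw [← hl, ← mul_assoc, he.ortho hki, zero_mul]
  have a2 : x * e k = 0 := by rw [← hr, mul_assoc, he.ortho (Ne.symm hkj), mul_zero]
  have a3 : e k * y = 0 := by rw [← hiy, ← mul_assoc, he.ortho hki, zero_mul]
  have a4 : y * e k = 0 := by rw [← hyj, mul_assoc, he.ortho (Ne.symm hkj), mul_zero]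
  have h := hT (e k) x
  rw [a1, a2, ← hy, a3, a4] at h
  simp only [sub_zero, map_zero, add_zero] at h
  exact sub_eq_zero.1 h.symm

variable [Fintype ι]

theorem CompleteOrthogonalIdempotents.peirce_induction (he : CompleteOrthogonalIdempotents e)
    {P : A → Prop} (zero : P 0) (add : ∀ x y, P x → P y → P (x + y))
    (homogeneous : ∀ i j x, P (e i * x * e j)) (x : A) : P x := by
  have h : x = ∑ i, ∑ j, e i * x * e j := by
    simp [← Finset.mul_sum, ← Finset.sum_mul, he.complete]
  rw [h]
  exact Finset.sum_induction _ P add zero fun i _ =>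
    Finset.sum_induction _ P add zero fun j _ => homogeneous i j x

/-- The diagonal part of a linear map. -/
noncomputable def diagonalPart (e : ι → A) (T : A →ₗ[K] A) : A →ₗ[K] A :=
  ∑ k, T ∘ₗ LinearMap.mulLeft K (e k) ∘ₗ LinearMap.mulRight K (e k)

theorem diagonalPart_apply (T : A →ₗ[K] A) (x : A) :
    diagonalPart e T x = ∑ k, T (e k * x * e k) := by
  simp [diagonalPart, mul_assoc]

theorem diagonalPart_of_ne (he : OrthogonalIdempotents e) (T : A →ₗ[K] A) {i j : ι} (h : i ≠ j)
    (x : A) : diagonalPart e T (e i * x * e j) = 0 := by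
  rw [diagonalPart_apply]
  refine Finset.sum_eq_zero fun k _ => ?_
  by_cases hk : k = i
  · subst hk; rw [mul_assoc, mul_assoc, he.ortho h.symm]; simp
  · rw [← mul_assoc, ← mul_assoc, he.ortho hk]; simp

theorem diagonalPart_same (he : OrthogonalIdempotents e) (T : A →ₗ[K] A) (i : ι) (x : A) :
    diagonalPart e T (e i * x * e i) = T (e i * x * e i) := by
  rw [diagonalPart_apply, Finset.sum_eq_single i]
  · rw [← mul_assoc, ← mul_assoc, (he.idem i).eq, mul_assoc, (he.idem i).eq]
  · intro k _ hk
    rw [← mul_assoc, ← mul_assoc, he.ortho hk]; simp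
  · simp

/-- Each `T (e k)` commutes with off-diagonal elements by `homogeneous`, and with diagonal ones
because these are multiples of the `e i`. So the diagonal part of `T` is central-valued, and what
remains is the Leibniz rule for homogeneous factors. -/
theorem HasThinPeirce.standard_of_diagonal (he : HasThinPeirce K e) (h2 : (2 : K) ≠ 0)
    {T : A →ₗ[K] A} (hT : IsLieDerivation T) (hd : ∀ i k, e k * T (e i) = T (e i) * e k) :
    IsStandardDecomposition T (T - diagonalPart e T) (diagonalPart e T) := by
  have ho := he.complete.toOrthogonalIdempotents
  have idl : ∀ i x, e i * (e i * x) = e i * x := fun i x => by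
    rw [← mul_assoc, (ho.idem i).eq]
  have idr : ∀ i (x : A), x * e i * e i = x * e i := fun i x => by
    rw [mul_assoc, (ho.idem i).eq]
  have hom : ∀ i j, i ≠ j → ∀ x, (e i * T (e i * x * e j) = T (e i * x * e j) ∧
      T (e i * x * e j) * e j = T (e i * x * e j)) ∧
      ∀ k, T (e k) * (e i * x * e j) = (e i * x * e j) * T (e k) := fun i j hij x =>
    hT.homogeneous h2 ho hd hij (by rw [mul_assoc, idl]) (idr j _)
  have central : ∀ k a, T (e k) * a = a * T (e k) := by
    intro k
    refine he.complete.peirce_induction (by simp) (fun x y hx hy => by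
      rw [mul_add, add_mul, hx, hy]) fun i j x => ?_
    by_cases hij : i = j
    · subst hij
      obtain ⟨c, hc⟩ := he.diag i x
      rw [hc, mul_smul_comm, smul_mul_assoc, hd]
    · exact (hom i j hij x).2 k
  have hΔ : ∀ x a, diagonalPart e T x * a = a * diagonalPart e T x := by
    intro x a
    rw [diagonalPart_apply, Finset.sum_mul, Finset.mul_sum]
    refine Finset.sum_congr rfl fun k _ => ?_
    obtain ⟨c, hc⟩ := he.diag k x
    rw [hc, map_smul, mul_smul_comm, smul_mul_assoc, central]
  set D := T - diagonalPart e T with hD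
  have D_ne : ∀ i j, i ≠ j → ∀ x, D (e i * x * e j) = T (e i * x * e j) := fun i j h x => by
    rw [hD, LinearMap.sub_apply, diagonalPart_of_ne ho T h, sub_zero]
  have D_same : ∀ i x, D (e i * x * e i) = 0 := fun i x => by
    rw [hD, LinearMap.sub_apply, diagonalPart_same ho T, sub_self]
  have D_hom : ∀ i j x, e i * D (e i * x * e j) = D (e i * x * e j) ∧
      D (e i * x * e j) * e j = D (e i * x * e j) := by
    intro i j x
    by_cases hij : i = j
    · subst hij; rw [D_same]; simp
    · rw [D_ne i j hij]; exact (hom i j hij x).1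
  have leibniz : IsAssocDerivation D := by
    refine he.complete.peirce_induction (by simp) (fun x y hx hy b => by
      rw [add_mul, map_add, map_add, hx, hy]; noncomm_ring) fun i j x => ?_
    refine he.complete.peirce_induction (by simp) (fun y z hy hz => by
      rw [mul_add, map_add, map_add, hy, hz]; noncomm_ring) fun k l y => ?_
    by_cases hjk : j = k
    swap
    · have a1 : (e i * x * e j) * (e k * y * e l) = 0 := by
        rw [mul_assoc _ (e j), ← mul_assoc (e j), ← mul_assoc (e j), ho.ortho hjk]; simp
      have a2 : D (e i * x * e j) * (e k * y * e l) = 0 := by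
        rw [← (D_hom i j x).2, mul_assoc _ (e j), ← mul_assoc (e j), ← mul_assoc (e j),
          ho.ortho hjk]; simp
      have a3 : (e i * x * e j) * D (e k * y * e l) = 0 := by
        rw [← (D_hom k l y).1, mul_assoc _ (e j), ← mul_assoc (e j), ho.ortho hjk]; simp
      rw [a1, a2, a3]; simp
    subst hjk
    by_cases hij : i = j
    · subst hij
      rw [D_same]
      obtain ⟨c, hc⟩ := he.diag i x
      rw [hc, smul_mul_assoc, smul_mul_assoc, mul_assoc, idl, map_smul, zero_mul, zero_add,
        ← mul_assoc, (D_hom i l y).1]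
    by_cases hjl : j = l
    · subst hjl
      rw [D_same]
      obtain ⟨c, hc⟩ := he.diag j y
      rw [hc, mul_smul_comm, mul_smul_comm, idr, map_smul, mul_zero, add_zero, (D_hom i j x).2]
    -- Opposite components: all three terms of the Leibniz rule vanish by `offDiag`, because `D`
    -- preserves components.
    by_cases hil : i = l
    · subst hil
      have a2 : D (e i * x * e j) * (e j * y * e i) = 0 := by
        have h := he.offDiag i j hij (D (e i * x * e j)) y
        rwa [(D_hom i j x).1, (D_hom i j x).2] at h
      have a3 : (e i * x * e j) * D (e j * y * e i) = 0 := by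
        have h := he.offDiag i j hij x (D (e j * y * e i))
        rwa [(D_hom j i y).1, (D_hom j i y).2] at h
      rw [he.offDiag i j hij, a2, a3]; simp
    -- Here i, j, l are distinct, so the products in reverse order vanish and the Lie identity
    -- becomes the Leibniz rule.
    have prod : (e i * x * e j) * (e j * y * e l) = e i * (x * e j * e j * y) * e l := by
      simp only [mul_assoc]
    have z1 : (e j * y * e l) * (e i * x * e j) = 0 := by
      rw [mul_assoc _ (e l), ← mul_assoc (e l), ← mul_assoc (e l), ho.ortho (Ne.symm hil)]; simp
    have z2 : (e j * y * e l) * T (e i * x * e j) = 0 := by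
      rw [← (hom i j hij x).1.1, mul_assoc _ (e l), ← mul_assoc (e l), ho.ortho (Ne.symm hil)]
      simp
    have z3 : T (e j * y * e l) * (e i * x * e j) = 0 := by
      rw [← (hom j l hjl y).1.2, mul_assoc _ (e l), ← mul_assoc (e l), ← mul_assoc (e l),
        ho.ortho (Ne.symm hil)]
      simp
    have h := hT (e i * x * e j) (e j * y * e l)
    rw [z1, z2, z3, sub_zero, sub_zero, sub_zero] at h
    rw [D_ne i j hij, D_ne j l hjl, ← h, prod, D_ne i l hil]
  refine ⟨leibniz, fun a => Subalgebra.mem_center_iff.2 fun b => (hΔ a b).symm, fun a b => ?_,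
    by rw [hD]; abel⟩
  -- `T` and `D` are both Lie derivations and differ by a central-valued map, so they agree on
  -- commutators.
  have h : diagonalPart e T (a * b - b * a) = T (a * b - b * a) - D (a * b - b * a) := by
    rw [hD, LinearMap.sub_apply]; abel
  rw [h, hT, map_sub, leibniz a b, leibniz b a, hD]
  simp only [LinearMap.sub_apply, sub_mul, mul_sub, hΔ a b, hΔ b a]
  abel

theorem IsLieDerivation.exists_diagonalizing (he : CompleteOrthogonalIdempotents e)
    {T : A →ₗ[K] A} (hT : IsLieDerivation T) :
    ∃ a : A, ∀ i k, e k * (T (e i) - (a * e i - e i * a)) = (T (e i) - (a * e i - e i * a)) * e k := by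
  classical
  have ho := he.toOrthogonalIdempotents
  -- Chosen so that a e l = T(e l) e l. The (k, l) entry of T(e i) - [a, e i], for k ≠ l, is then
  -- that of [T(e i), e l] + [e i, T(e l)] = T([e i, e l]) = 0.
  refine ⟨∑ j, T (e j) * e j, fun i => ?_⟩
  set a := ∑ j, T (e j) * e j with ha
  have hae : ∀ l, a * e l = T (e l) * e l := fun l => by
    rw [ha, Finset.sum_mul, Finset.sum_eq_single l]
    · rw [mul_assoc, (ho.idem l).eq]
    · intro k _ hk; rw [mul_assoc, ho.ortho hk, mul_zero]
    · simp
  set t := T (e i) - (a * e i - e i * a) with ht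
  have off : ∀ k l, k ≠ l → e k * t * e l = 0 := by
    intro k l hkl
    have h := hT (e i) (e l)
    have hc : e i * e l - e l * e i = 0 := by
      by_cases hil : i = l
      · rw [hil, sub_self]
      · rw [ho.ortho hil, ho.ortho (Ne.symm hil), sub_self]
    rw [hc, map_zero] at h
    have h' := congrArg (fun u => e k * u * e l) h
    have hl := (ho.idem l).eq
    have key : e k * t * e l = e k * ((T (e i) * e l - e l * T (e i)) +
        (e i * T (e l) - T (e l) * e i)) * e l := by
      have e1 : e k * (T (e i) * e l) * e l = e k * T (e i) * e l := by
        simp only [mul_assoc, hl]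
      have e2 : e k * (e l * T (e i)) * e l = 0 := by
        rw [← mul_assoc, ho.ortho hkl]; simp
      have e3 : e k * (e i * a) * e l = e k * (e i * T (e l)) * e l := by
        simp only [mul_assoc, hae]
      have e4 : e k * (a * e i) * e l = e k * (T (e l) * e i) * e l := by
        by_cases hil : i = l
        · subst hil; rw [hae]
        · simp only [mul_assoc, ho.ortho hil, mul_zero]
      rw [ht]
      simp only [mul_sub, sub_mul, mul_add, add_mul, e1, e2, e3, e4]
      abel
    rw [key]
    simpa using h'.symm
  intro k
  have h1 : e k * t = e k * t * e k := by
    conv_lhs => rw [← mul_one (e k * t), ← he.complete, Finset.mul_sum]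
    exact Finset.sum_eq_single k (fun l _ hl => off k l hl.symm) (by simp)
  have h3 : t * e k = e k * t * e k := by
    conv_lhs => rw [← one_mul (t * e k), ← he.complete, Finset.sum_mul]
    rw [Finset.sum_eq_single k (fun l _ hl => by rw [← mul_assoc]; exact off l k hl) (by simp),
      mul_assoc]
  rw [h1, h3]

/-- Centrality gives D(e) = 2 e D(e) for an idempotent e; multiplying by e yields e D(e) = 0, so
D(e) = 0 in any characteristic. Off-diagonal elements are commutators: x = [e i, x]. -/
theorem HasThinPeirce.derivation_eq_zero (he : HasThinPeirce K e) {D : A →ₗ[K] A}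
    (hD : IsAssocDerivation D) (hc : ∀ a, D a ∈ Subalgebra.center K A)
    (h0 : ∀ a b, D (a * b - b * a) = 0) : D = 0 := by
  have ho := he.complete.toOrthogonalIdempotents
  have hidem : ∀ i, D (e i) = 0 := by
    intro i
    have h := hD (e i) (e i)
    rw [(ho.idem i).eq, ← Subalgebra.mem_center_iff.1 (hc (e i)) (e i)] at h
    have h' := congrArg (e i * ·) h
    simp only [mul_add, ← mul_assoc, (ho.idem i).eq] at h'
    rw [left_eq_add] at h'
    rw [h, h', add_zero]
  ext x
  refine he.complete.peirce_induction (P := fun x => D x = (0 : A →ₗ[K] A) x) (by simp)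
    (fun x y hx hy => by rw [map_add, map_add, hx, hy]) (fun i j x => ?_) x
  by_cases hij : i = j
  · subst hij
    obtain ⟨c, h⟩ := he.diag i x
    simp [h, hidem]
  · have h := h0 (e i) (e i * x * e j)
    rwa [mul_assoc _ (e j), ho.ortho (Ne.symm hij), mul_zero, sub_zero, ← mul_assoc, ← mul_assoc,
      (ho.idem i).eq] at h

theorem HasThinPeirce.existsUnique_standard (he : HasThinPeirce K e) (h2 : (2 : K) ≠ 0)
    {T : A →ₗ[K] A} (hT : IsLieDerivation T) :
    ∃! DΔ : (A →ₗ[K] A) × (A →ₗ[K] A), IsStandardDecomposition T DΔ.1 DΔ.2 := by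
  obtain ⟨a, ha⟩ := hT.exists_diagonalizing he.complete
  set I : A →ₗ[K] A := LinearMap.mulLeft K a - LinearMap.mulRight K a with hI
  have hI' : ∀ x, I x = a * x - x * a := fun x => by simp [hI]
  have hID : IsAssocDerivation I := fun x y => by simp only [hI']; noncomm_ring
  have hT' : IsLieDerivation (T - I) := fun x y => by
    simp only [LinearMap.sub_apply, hT x y, hI']; noncomm_ring
  obtain ⟨s1, s2, s3, s4⟩ := he.standard_of_diagonal h2 hT' fun i k => by
    simpa only [LinearMap.sub_apply, hI'] using ha i k
  set D := T - I - diagonalPart e (T - I)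
  set Δ := diagonalPart e (T - I)
  have hs : IsStandardDecomposition T (D + I) Δ := by
    refine ⟨fun x y => ?_, s2, s3, ?_⟩
    · simp only [LinearMap.add_apply, s1 x y, hID x y]; noncomm_ring
    · rw [add_right_comm, ← s4, sub_add_cancel]
  refine ⟨(D + I, Δ), hs, ?_⟩
  rintro ⟨D', Δ'⟩ ⟨r1, r2, r3, r4⟩
  have hdiff : D' - (D + I) = Δ - Δ' := by
    rw [sub_eq_sub_iff_add_eq_add, ← r4, hs.2.2.2, add_comm]
  have hz : D' - (D + I) = 0 := by
    refine he.derivation_eq_zero (fun x y => ?_) (fun x => ?_) fun x y => ?_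
    · simp only [LinearMap.sub_apply, r1 x y, hs.1 x y]; noncomm_ring
    · rw [hdiff]; exact sub_mem (s2 x) (r2 x)
    · rw [hdiff, LinearMap.sub_apply, s3, r3, sub_zero]
  refine Prod.ext (sub_eq_zero.1 hz) ?_
  rw [hdiff] at hz
  exact (sub_eq_zero.1 hz).symm

end Peirce

/-! ### Vertex idempotents of the path algebra -/

namespace PathAlgebra

variable {K : Type w} [Field K] {V : Type u} [Quiver.{v} V]

theorem induction {P : PathAlgebra K V → Prop} (zero : P 0)
    (add : ∀ x y, P x → P y → P (x + y)) (single : ∀ (c : K) p, P (c • of K p)) (x) : P x := by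
  refine Finsupp.induction_linear (motive := P) x zero add fun p c => ?_
  have h : (Finsupp.single p c : QPath V →₀ K) = c • Finsupp.single p (1 : K) := by simp
  exact (congrArg P h).mpr (single c p)

variable [Fintype V]

theorem idem_mul_of_of_ne {i : V} {p : QPath V} (h : p.tgt ≠ i) : idem K i * of K p = 0 := by
  simp [idem, of_mul_of, mulPath, h]

theorem of_mul_idem_of_ne {i : V} {p : QPath V} (h : p.src ≠ i) : of K p * idem K i = 0 := by
  simp [idem, of_mul_of, mulPath, h.symm]

theorem of_mul_idem_src (p : QPath V) : of K p * idem K p.src = of K p := by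
  simp [idem, of_mul_of, mulPath]

theorem idem_tgt_mul_of (p : QPath V) : idem K p.tgt * of K p = of K p := by
  simp [idem, of_mul_of, mulPath]

theorem of_mul_of_comp {a b c : V} (p : Quiver.Path a b) (q : Quiver.Path b c) :
    of K ⟨b, c, q⟩ * of K ⟨a, b, p⟩ = of K ⟨a, c, p.comp q⟩ := by
  simp [of_mul_of, mulPath]

theorem completeOrthogonalIdempotents_idem :
    CompleteOrthogonalIdempotents (fun i : V => idem K i) where
  idem _ := idem_tgt_mul_of ⟨_, _, Quiver.Path.nil⟩
  ortho _ j hij := idem_mul_of_of_ne (p := ⟨j, j, Quiver.Path.nil⟩) hij.symm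
  complete := one_def.symm

end PathAlgebra

/-! ### Peirce decomposition of the generalized one-point extension -/

section Extension

open Quiver PathAlgebra

variable {K : Type w} [Field K] {V : Type u} [Quiver.{v} V] [Fintype V]

/-- The canonical projection onto the generalized one-point extension. -/
noncomputable def toExtension (ρ : Set (PathAlgebra K V)) :
    PathAlgebra K (Symmetrify V) →ₐ[K] GenOnePointExtension K V ρ :=
  RingCon.mkₐ K (TwoSidedIdeal.span (extensionRelations ρ)).ringCon

theorem toExtension_surjective (ρ : Set (PathAlgebra K V)) :
    Function.Surjective (toExtension ρ) :=
  Quotient.mk''_surjective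

theorem toExtension_eq_zero {ρ : Set (PathAlgebra K V)} {x : PathAlgebra K (Symmetrify V)}
    (hx : x ∈ extensionRelations ρ) : toExtension ρ x = 0 :=
  (RingCon.eq _).2 ((TwoSidedIdeal.mem_iff _ _).1 (TwoSidedIdeal.subset_span hx))

theorem toExtension_pos_mul_neg (ρ : Set (PathAlgebra K V)) {i j k l : V} (α : i ⟶ j)
    (β : k ⟶ l) : toExtension ρ (arrow K α.toPos) * toExtension ρ (arrow K β.toNeg) = 0 := by
  rw [← map_mul]
  exact toExtension_eq_zero (Or.inl (Or.inr ⟨i, j, k, l, α, β, rfl⟩))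

theorem toExtension_neg_mul_pos (ρ : Set (PathAlgebra K V)) {i j k l : V} (α : i ⟶ j)
    (β : k ⟶ l) : toExtension ρ (arrow K α.toNeg) * toExtension ρ (arrow K β.toPos) = 0 := by
  rw [← map_mul]
  exact toExtension_eq_zero (Or.inr ⟨i, j, k, l, α, β, rfl⟩)

/-- A path of the doubled quiver that is nonzero in the extension is trivial, positive or
negative. -/
theorem toExtension_path_cases (ρ : Set (PathAlgebra K V)) {a b : Symmetrify V} (p : Path a b) :
    toExtension ρ (of K ⟨a, b, p⟩) = 0 ∨ p.length = 0 ∨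
      (∃ p' : @Path V _ a b, p'.length = p.length ∧ ∃ (i j : V) (α : i ⟶ j) (x : _),
        toExtension ρ (of K ⟨a, b, p⟩) = toExtension ρ (arrow K α.toPos) * x) ∨
      (∃ p' : @Path V _ b a, p'.length = p.length ∧ ∃ (i j : V) (α : i ⟶ j) (x : _),
        toExtension ρ (of K ⟨a, b, p⟩) = toExtension ρ (arrow K α.toNeg) * x) := by
  induction p with
  | nil => exact Or.inr (Or.inl rfl)
  | @cons b c p f ih =>
    have hmul : toExtension ρ (of K ⟨a, c, p.cons f⟩) =
        toExtension ρ (arrow K f) * toExtension ρ (of K ⟨a, b, p⟩) := by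
      rw [← map_mul]; exact congrArg _ (of_mul_of_comp p f.toPath).symm
    -- The induction hypothesis exposes the last arrow of `p` as a left factor, so a new arrow of
    -- the opposite kind kills the product.
    rcases ih with h | h | ⟨p', hp', i, j, α, x, hx⟩ | ⟨p', hp', i, j, α, x, hx⟩
    · left; rw [hmul, h, mul_zero]
    · obtain rfl := Path.eq_of_length_zero p h
      rcases f with f | f
      · exact Or.inr (Or.inr (Or.inl ⟨@Hom.toPath V _ _ _ f, congrArg (· + 1) h.symm, _, _, f, _, hmul⟩))
      · exact Or.inr (Or.inr (Or.inr ⟨@Hom.toPath V _ _ _ f, congrArg (· + 1) h.symm, _, _, f, _, hmul⟩))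
    · rcases f with f | f
      · exact Or.inr (Or.inr (Or.inl ⟨p'.cons f, congrArg (· + 1) hp', _, _, f, _, hmul⟩))
      · left
        rw [hmul, hx, ← mul_assoc]
        exact (congrArg (· * x) (toExtension_neg_mul_pos ρ f α)).trans (zero_mul x)
    · rcases f with f | f
      · left
        rw [hmul, hx, ← mul_assoc]
        exact (congrArg (· * x) (toExtension_pos_mul_neg ρ f α)).trans (zero_mul x)
      -- Starred arrows run backwards, so the new arrow goes at the start of `p'`.
      · refine Or.inr (Or.inr (Or.inr ⟨(@Hom.toPath V _ _ _ f).comp p', ?_, _, _, f, _, hmul⟩))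
        exact (Path.length_comp (V := V) _ p').trans ((add_comm _ _).trans (congrArg (· + 1) hp'))

/-- A surviving cycle of positive length would consist of arrows of one kind, and so give an
oriented cycle of `V` of the same length. -/
theorem toExtension_cycle (hV : HasNoOrientedCycles V) (ρ : Set (PathAlgebra K V))
    {a : Symmetrify V} (p : Path a a) (hp : p.length ≠ 0) :
    toExtension ρ (of K ⟨a, a, p⟩) = 0 := by
  rcases toExtension_path_cases ρ p with h | h | ⟨p', h, _⟩ | ⟨p', h, _⟩
  · exact h
  · exact absurd h hp
  · exact absurd (h.symm.trans (hV a p')) hp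
  · exact absurd (h.symm.trans (hV a p')) hp

theorem hasThinPeirce_extension (hV : HasNoOrientedCycles V) (ρ : Set (PathAlgebra K V)) :
    HasThinPeirce K (fun i : Symmetrify V => toExtension ρ (idem K i)) where
  complete := completeOrthogonalIdempotents_idem.map (toExtension ρ).toRingHom
  diag i x := by
    obtain ⟨x, rfl⟩ := toExtension_surjective ρ x
    refine PathAlgebra.induction (P := fun x => ∃ c : K, toExtension ρ (idem K i) *
      toExtension ρ x * toExtension ρ (idem K i) = c • toExtension ρ (idem K i))
      ⟨0, by simp⟩ ?_ ?_ x
    · rintro x y ⟨c, hc⟩ ⟨d, hd⟩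
      exact ⟨c + d, by rw [map_add, mul_add, add_mul, hc, hd, add_smul]⟩
    · intro c p
      suffices h : ∃ d : K, toExtension ρ (idem K i * of K p * idem K i) =
          d • toExtension ρ (idem K i) by
        obtain ⟨d, hd⟩ := h
        refine ⟨c * d, ?_⟩
        rw [map_smul, mul_smul_comm, smul_mul_assoc, ← map_mul, ← map_mul, hd, mul_smul]
      obtain ⟨a, b, p⟩ := p
      by_cases hb : b = i
      swap
      · exact ⟨0, by rw [idem_mul_of_of_ne hb]; simp⟩
      by_cases ha : a = i
      swap
      · exact ⟨0, by rw [mul_assoc, of_mul_idem_of_ne ha]; simp⟩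
      subst hb
      subst ha
      rw [idem_tgt_mul_of ⟨_, _, p⟩, of_mul_idem_src ⟨_, _, p⟩]
      by_cases hp : p.length = 0
      · obtain rfl := Path.eq_nil_of_length_zero p hp
        exact ⟨1, (one_smul _ _).symm⟩
      · exact ⟨0, by rw [toExtension_cycle hV ρ p hp, zero_smul]⟩
  offDiag i j hij x y := by
    obtain ⟨x, rfl⟩ := toExtension_surjective ρ x
    obtain ⟨y, rfl⟩ := toExtension_surjective ρ y
    simp only [← map_mul]
    refine PathAlgebra.induction (P := fun x => toExtension ρ
      ((idem K i * x * idem K j) * (idem K j * y * idem K i)) = 0) (by simp)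
      (fun x x' hx hx' => by simp only [mul_add, add_mul, map_add, hx, hx', add_zero])
      (fun c p => ?_) x
    refine PathAlgebra.induction (P := fun y => toExtension ρ
      ((idem K i * (c • of K p) * idem K j) * (idem K j * y * idem K i)) = 0) (by simp)
      (fun x x' hx hx' => by simp only [mul_add, add_mul, map_add, hx, hx', add_zero])
      (fun d q => ?_) y
    simp only [mul_smul_comm, smul_mul_assoc, map_smul]
    refine smul_eq_zero_of_right d (smul_eq_zero_of_right c ?_)
    obtain ⟨a, b, p⟩ := p
    obtain ⟨a', b', q⟩ := q
    by_cases hb : b = i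
    swap
    · rw [idem_mul_of_of_ne hb]; simp
    by_cases ha : a = j
    swap
    · rw [mul_assoc (idem K i), of_mul_idem_of_ne (p := ⟨a, b, p⟩) ha]; simp
    by_cases hb' : b' = j
    swap
    · rw [idem_mul_of_of_ne (p := ⟨a', b', q⟩) hb']; simp
    by_cases ha' : a' = i
    swap
    · rw [mul_assoc (idem K j), of_mul_idem_of_ne (p := ⟨a', b', q⟩) ha']; simp
    subst hb ha hb' ha'
    rw [idem_tgt_mul_of ⟨_, _, p⟩, idem_tgt_mul_of ⟨_, _, q⟩, of_mul_idem_src ⟨_, _, p⟩,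
      of_mul_idem_src ⟨_, _, q⟩, of_mul_of_comp]
    -- The composite is a cycle; were its length 0, `q` would be trivial and i = j.
    refine toExtension_cycle hV ρ _ fun h => hij ?_
    rw [Path.length_comp] at h
    exact Path.eq_of_length_zero q (by omega)

end Extension

theorem proposition3p15 (K : Type w) [Field K] (h2 : (2 : K) ≠ 0)
    (V : Type u) [Quiver.{v} V] [Fintype V] [∀ i j : V, Finite (i ⟶ j)]
    (hcard : 2 ≤ Fintype.card V) (hV : HasNoOrientedCycles V)
    (ρ : Set (PathAlgebra K V)) (hρ : ∀ σ ∈ ρ, IsQuiverRelation σ)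
    (Θ : GenOnePointExtension K V ρ →ₗ[K] GenOnePointExtension K V ρ) (hΘ : IsLieDerivation Θ) :
    ∃! DΔ : (GenOnePointExtension K V ρ →ₗ[K] GenOnePointExtension K V ρ) ×
        (GenOnePointExtension K V ρ →ₗ[K] GenOnePointExtension K V ρ),
      IsStandardDecomposition Θ DΔ.1 DΔ.2 :=
  (hasThinPeirce_extension hV ρ).existsUnique_standard h2 hΘ
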